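/- Let $\Omega\subset\mathbb R^N$ be a bounded domain (nonempty, open, connected) with Lipschitz boundary, and let $K:\mathbb R^N\setminus\{0\}\to(0,\infty)$ satisfy: (i) $mK\in L^1(\mathbb R^N)$, where $m(x)=\min\{|x|^2,1\}$; (ii) there are $\alpha>0$ and $s\in(0,1)$ with $N>2s$ such that $K(x)\ge\alpha|x|^{-(N+2s)}$ for all $x\ne0$; (iii) $K(-x)=K(x)$ for all $x\neq 0$. Let $$X_K(\Omega)=\Big\{u\in L^2(\mathbb R^N):\ [u]_K^2:=\int_{\mathbb R^{2N}}(u(x)-u(y))^2K(x-y)\,dx\,dy<\infty,\ u=0\text{ a.e. in }\mathbb R^N\setminus\Omega\Big\},$$ with the scalar product $\langle u,v\rangle=\int_{\mathbb R^{2N}}(u(x)-u(y))(v(x)-v(y))K(x-y)\,dx\,dy$ and the norm $\|u\|=[u]_K$. For $\rho\in L^\infty(\Omega)\setminus\{0\}$, an eigenfunction with eigenvalue $\lambda\in\mathbb R$ is a $u\in X_K(\Omega)\setminus\{0\}$ such that $\langle u,v\rangle=\lambda\int_\Omega\rho uv\,dx$ for all $v\in X_K(\Omega)$. The weight $\rho$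 satisfies the unique continuation property (u.c.p.) if $|\{x\in\Omega:u(x)=0\}|=0$ for every eigenfunction $u$ (with any eigenvalue). For an integer $k>0$ let $\mathcal F_k$ be the set of the $k$-dimensional linear subspaces of $X_K(\Omega)$, and define $$\lambda_k(\rho)^{-1}=\sup_{F\in\mathcal F_k}\ \inf_{u\in F,\,\|u\|=1}\int_\Omega\rho u^2\,dx\quad\text{if }\rho^+\not\equiv0,\qquad \lambda_{-k}(\rho)^{-1}=\inf_{F\in\mathcal F_k}\ \sup_{u\in F,\,\|u\|=1}\int_\Omega\rho u^2\,dx\quad\text{if }\rho^-\not\equiv0.$$ An index $k\in\mathbb Z\setminus\{0\}$ is admissible for $\rho$ if $k>0$ and $\rho^+\not\equiv0$, or $k<0$ and $\rho^-\not\equiv0$. Inequalities and identities between functions are meant almost everywhere in $\Omega$. **Theorem.** If $\rho\in L^\infty(\Omega)\setminus\{0\}$ does not satisfy u.c.p., then there exist $\tilde\rho\in L^\infty(\Omega)\setminus\{0\}$ with $\rho\le\tilde\rho$ or $\rho\ge\tilde\rho$, and $\rho\not\equiv\tilde\rho$, and an index $k\in\mathbb Z\setminus\{0\}$, admissible for both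 $\rho$ and $\tilde\rho$, such that $\lambda_k(\rho)=\lambda_k(\tilde\rho)$. -/

import Mathlib

open MeasureTheory Set
open scoped ENNReal NNReal Topology

noncomputable section

namespace NonlocalEig

/-- `ℝ^N` with its Euclidean norm. -/
abbrev Space (N : ℕ) : Type := EuclideanSpace ℝ (Fin N)

/-- Near every boundary point, `Ω` is the set of points lying strictly above the graph of a
Lipschitz function, in the direction of some unit vector `e`; the function is evaluated at the
orthogonal projection `y - ⟪e, y⟫ e` of `y` onto the hyperplane orthogonal to `e`. -/
def HasLipschitzBoundary {N : ℕ} (Ω : Set (Space N)) : Prop :=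
  ∀ x₀ ∈ frontier Ω, ∃ e : Space N, ‖e‖ = 1 ∧ ∃ (C : ℝ≥0) (φ : Space N → ℝ),
    LipschitzWith C φ ∧ ∃ U ∈ 𝓝 x₀, ∀ y ∈ U,
      (y ∈ Ω ↔ φ (y - inner ℝ e y • e) < inner ℝ e y)

/-- Bounded domain (nonempty, open, connected) with Lipschitz boundary. -/
structure IsLipschitzDomain {N : ℕ} (Ω : Set (Space N)) : Prop where
  isOpen : IsOpen Ω
  isConnected : IsConnected Ω
  isBounded : Bornology.IsBounded Ω
  lipschitz : HasLipschitzBoundary Ω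

/-- The hypotheses on the kernel `K : ℝ^N ∖ {0} → (0, ∞)`; the value `K 0` plays no role. -/
structure IsKernel {N : ℕ} (K : Space N → ℝ) : Prop where
  pos : ∀ x, x ≠ 0 → 0 < K x
  integrable : Integrable (fun x => min (‖x‖ ^ 2) 1 * K x) volume
  lower_bound : ∃ α s : ℝ, 0 < α ∧ 0 < s ∧ s < 1 ∧ 2 * s < (N : ℝ) ∧
    ∀ x, x ≠ 0 → α * ‖x‖ ^ (-((N : ℝ) + 2 * s)) ≤ K x
  symm : ∀ x, x ≠ 0 → K (-x) = K x

/-- The integrand `(u(x) - u(y)) (v(x) - v(y)) K(x - y)` on `ℝ^N × ℝ^N`. -/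
def energyDensity {N : ℕ} (K : Space N → ℝ) (u v : Space N → ℝ) (p : Space N × Space N) : ℝ :=
  (u p.1 - u p.2) * (v p.1 - v p.2) * K (p.1 - p.2)

/-- `[u]_K < ∞`. (For a measurable `u` the density `(u(x) - u(y))² K(x - y)` is measurable and
nonnegative, so that its integral is finite exactly when it is integrable.) -/
def FiniteEnergy {N : ℕ} (K : Space N → ℝ) (u : Space N → ℝ) : Prop :=
  Integrable (energyDensity K u u) (volume : Measure (Space N × Space N))

theorem energyDensity_congr {N : ℕ} (K : Space N → ℝ) {u u' v v' : Space N → ℝ}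
    (hu : u =ᵐ[volume] u') (hv : v =ᵐ[volume] v') :
    energyDensity K u v =ᵐ[(volume : Measure (Space N × Space N))] energyDensity K u' v' := by
  have q1 : Measure.QuasiMeasurePreserving (Prod.fst : Space N × Space N → Space N)
      volume volume := Measure.quasiMeasurePreserving_fst
  have q2 : Measure.QuasiMeasurePreserving (Prod.snd : Space N × Space N → Space N)
      volume volume := Measure.quasiMeasurePreserving_snd
  filter_upwards [q1.ae_eq_comp hu, q2.ae_eq_comp hu, q1.ae_eq_comp hv, q2.ae_eq_comp hv]
    with p h1 h2 h3 h4
  simp only [Function.comp_apply] at h1 h2 h3 h4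
  simp only [energyDensity, h1, h2, h3, h4]

theorem FiniteEnergy.congr {N : ℕ} {K : Space N → ℝ} {u v : Space N → ℝ}
    (hu : FiniteEnergy K u) (h : u =ᵐ[volume] v) : FiniteEnergy K v :=
  Integrable.congr hu (energyDensity_congr K h h)

theorem kernel_aestronglyMeasurable {N : ℕ} {K : Space N → ℝ} (hK : IsKernel K) :
    AEStronglyMeasurable K volume := by
  obtain ⟨_, s, _, hs, _, hN, _⟩ := hK.lower_bound
  have hN0 : 0 < N := by
    have : (0 : ℝ) < N := by linarith
    exact_mod_cast this
  have : Nonempty (Fin N) := ⟨⟨0, hN0⟩⟩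
  have hm : Measurable (fun x : Space N => (min (‖x‖ ^ 2) 1)⁻¹) := by fun_prop
  refine (hK.integrable.1.mul hm.aestronglyMeasurable).congr ?_
  filter_upwards [compl_mem_ae_iff.2 (measure_singleton (0 : Space N))] with x hx
  have hx0 : x ≠ 0 := hx
  have : min (‖x‖ ^ 2) 1 ≠ 0 := (lt_min (by positivity) one_pos).ne'
  simp only [Pi.mul_apply]
  field_simp

theorem energyDensity_aestronglyMeasurable {N : ℕ} {K : Space N → ℝ} (hK : IsKernel K)
    {u v : Space N → ℝ} (hu : AEStronglyMeasurable u volume)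
    (hv : AEStronglyMeasurable v volume) :
    AEStronglyMeasurable (energyDensity K u v) (volume : Measure (Space N × Space N)) := by
  have hk : AEStronglyMeasurable (fun p : Space N × Space N => K (p.1 - p.2)) volume :=
    (kernel_aestronglyMeasurable hK).comp_quasiMeasurePreserving
      (quasiMeasurePreserving_sub_of_right_invariant volume volume)
  exact ((hu.comp_fst.sub hu.comp_snd).mul (hv.comp_fst.sub hv.comp_snd)).mul hk

theorem FiniteEnergy.add {N : ℕ} {K : Space N → ℝ} (hK : IsKernel K) {u v : Space N → ℝ}
    (hum : AEStronglyMeasurable u volume) (hvm : AEStronglyMeasurable v volume)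
    (hu : FiniteEnergy K u) (hv : FiniteEnergy K v) : FiniteEnergy K (u + v) := by
  refine Integrable.mono' ((Integrable.add hu hv).const_mul 2)
    (energyDensity_aestronglyMeasurable hK (hum.add hvm) (hum.add hvm)) (ae_of_all _ ?_)
  rintro ⟨x, y⟩
  by_cases h : x - y = 0
  · have : x = y := sub_eq_zero.1 h
    simp [energyDensity, this]
  · have hk := hK.pos _ h
    simp only [energyDensity, Pi.add_apply, Real.norm_eq_abs]
    rw [abs_of_nonneg (mul_nonneg (mul_self_nonneg _) hk.le)]
    nlinarith [mul_nonneg hk.le (mul_self_nonneg ((u x - u y) - (v x - v y)))]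

theorem FiniteEnergy.smul {N : ℕ} {K : Space N → ℝ} (c : ℝ) {u : Space N → ℝ}
    (hu : FiniteEnergy K u) : FiniteEnergy K (c • u) := by
  refine (Integrable.const_mul hu (c ^ 2)).congr (ae_of_all _ fun p => ?_)
  simp only [energyDensity, Pi.smul_apply, smul_eq_mul]
  ring

/-- The space `X_K(Ω)` of the (classes of) functions `u ∈ L²(ℝ^N)` with `[u]_K < ∞` and `u = 0`
a.e. in `ℝ^N ∖ Ω`. Its norm is `normK` below, not the norm inherited from `L²`. -/
def XK {N : ℕ} (Ω : Set (Space N)) {K : Space N → ℝ} (hK : IsKernel K) :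
    Submodule ℝ (Lp ℝ 2 (volume : Measure (Space N))) where
  carrier := {u | FiniteEnergy K u ∧ u =ᵐ[volume.restrict Ωᶜ] (0 : Space N → ℝ)}
  zero_mem' := by
    have h := Lp.coeFn_zero ℝ 2 (volume : Measure (Space N))
    refine ⟨FiniteEnergy.congr ?_ h.symm, ae_restrict_of_ae h⟩
    refine (integrable_zero _ _ _).congr (ae_of_all _ fun p => ?_)
    simp [energyDensity]
  add_mem' := by
    rintro u v ⟨hu, hu0⟩ ⟨hv, hv0⟩
    have h := Lp.coeFn_add u v
    refine ⟨(FiniteEnergy.add hK (Lp.aestronglyMeasurable u) (Lp.aestronglyMeasurable v)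
      hu hv).congr h.symm, ?_⟩
    filter_upwards [ae_restrict_of_ae h, hu0, hv0] with x h1 h2 h3
    exact h1.trans (by simp [h2, h3])
  smul_mem' := by
    rintro c u ⟨hu, hu0⟩
    have h := Lp.coeFn_smul c u
    refine ⟨(FiniteEnergy.smul c hu).congr h.symm, ?_⟩
    filter_upwards [ae_restrict_of_ae h, hu0] with x h1 h2
    exact h1.trans (by simp [h2])

variable {N : ℕ} {Ω : Set (Space N)} {K : Space N → ℝ} {hK : IsKernel K}

/-- The scalar product of `X_K(Ω)`. -/
def innerK (u v : XK Ω hK) : ℝ :=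
  ∫ p : Space N × Space N, energyDensity K (u : Lp ℝ 2 volume) (v : Lp ℝ 2 volume) p

/-- The norm `[u]_K` of `X_K(Ω)`. -/
def normK (u : XK Ω hK) : ℝ := √(innerK u u)

/-- The weights: `L^∞(Ω)`, with its a.e. equality and its a.e. order. -/
abbrev Weight (Ω : Set (Space N)) : Type := Lp ℝ ∞ (volume.restrict Ω)

/-- `∫_Ω ρ u v dx`. -/
def weightForm (ρ : Weight Ω) (u v : XK Ω hK) : ℝ :=
  ∫ x in Ω, ρ x * (u : Lp ℝ 2 volume) x * (v : Lp ℝ 2 volume) x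

/-- `u` is an eigenfunction with eigenvalue `l` of the problem `L_K u = l ρ u` in `Ω`, `u = 0`
outside `Ω`: a nontrivial weak solution. -/
def IsEigenfunction (ρ : Weight Ω) (l : ℝ) (u : XK Ω hK) : Prop :=
  u ≠ 0 ∧ ∀ v : XK Ω hK, innerK u v = l * weightForm ρ u v

variable (hK) in
/-- Unique continuation property: every eigenfunction (for every eigenvalue) vanishes in `Ω` at
most on a null set. -/
def HasUCP (ρ : Weight Ω) : Prop :=
  ∀ (l : ℝ) (u : XK Ω hK), IsEigenfunction ρ l u →
    volume {x ∈ Ω | (u : Lp ℝ 2 volume) x = 0} = 0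

/-- The values `∫_Ω ρ u² dx` for `u ∈ F`, `‖u‖ = 1`. -/
def rayleighValues (ρ : Weight Ω) (F : Submodule ℝ (XK Ω hK)) : Set ℝ :=
  (fun u => weightForm ρ u u) '' {u | u ∈ F ∧ normK u = 1}

variable (hK) in
/-- For `k > 0`: `sup` over the `k`-dimensional subspaces `F` of `X_K(Ω)` of the `inf` of
`∫_Ω ρ u² dx` over `u ∈ F`, `‖u‖ = 1`. -/
def supInf (ρ : Weight Ω) (k : ℕ) : ℝ :=
  sSup {t | ∃ F : Submodule ℝ (XK Ω hK), Module.finrank ℝ F = k ∧ t = sInf (rayleighValues ρ F)}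

variable (hK) in
/-- For `k > 0`: `inf` over the `k`-dimensional subspaces `F` of `X_K(Ω)` of the `sup` of
`∫_Ω ρ u² dx` over `u ∈ F`, `‖u‖ = 1`. -/
def infSup (ρ : Weight Ω) (k : ℕ) : ℝ :=
  sInf {t | ∃ F : Submodule ℝ (XK Ω hK), Module.finrank ℝ F = k ∧ t = sSup (rayleighValues ρ F)}

variable (hK) in
/-- The variational eigenvalue `λ_k(ρ)`, `k ∈ ℤ ∖ {0}`; meaningful for admissible `k`. -/
def eigenvalue (ρ : Weight Ω) (k : ℤ) : ℝ :=
  if 0 < k then (supInf hK ρ k.natAbs)⁻¹ else (infSup hK ρ k.natAbs)⁻¹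

/-- `k ∈ ℤ ∖ {0}` is admissible for `ρ`: positive `k` if `ρ⁺ ≢ 0`, negative `k` if `ρ⁻ ≢ 0`. -/
def Admissible (ρ : Weight Ω) (k : ℤ) : Prop :=
  (0 < k ∧ ρ⁺ ≠ 0) ∨ (k < 0 ∧ ρ⁻ ≠ 0)

end NonlocalEig

end

/-!
Let `u` be an eigenfunction with eigenvalue `λ > 0` that vanishes on a subset of `Ω` of positive
measure, and let `χ ≥ 0` be the indicator function of its zero set. For every `t` the function `u`
is still an eigenfunction of the weight `ρ + t χ` with the same eigenvalue `λ = 1 / c`. Hence `c` is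
the `k`-th max-min value of `ρ + t χ` as soon as `k` is the largest dimension of a subspace on which
`∫_Ω (ρ + t χ) v² ≥ c ‖v‖²`: adding `u` to a subspace with a strictly better bound would raise the
dimension. This largest dimension is monotone in `t`, so it is constant for small `t > 0`, and for
the resulting `k` the equality `λ_k = λ` passes to `t = 0` by continuity. Negative `λ` reduce to
positive ones by `ρ ↦ -ρ`.

The dimension is finite because the quadratic forms of the weights are compact relative to the
energy: on a cube of side `δ` the lower bound on the kernel gives a Poincaré inequality with
constant of order `δ ^ (2 * s)`.
-/

noncomputable section

namespace NonlocalEig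

section MaxMin

open Module

variable {V : Type*} [AddCommGroup V] [Module ℝ V] {a b d : LinearMap.BilinForm ℝ V}

/-- The Rayleigh values of the pencil `(a, b)` on the subspace `F`: the values of `b` on the
`a`-unit vectors of `F`. -/
def rayleighRange (a b : LinearMap.BilinForm ℝ V) (F : Submodule ℝ V) : Set ℝ :=
  (fun v => b v v) '' {v | v ∈ F ∧ a v v = 1}

/-- The `k`-th max-min value of the form `b` relative to the form `a`, in the sense of Courant and
Fischer. It is a junk value when there is no `k`-dimensional subspace or `k = 0`. -/
def maxMin (a b : LinearMap.BilinForm ℝ V) (k : ℕ) : ℝ :=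
  sSup {t | ∃ F : Submodule ℝ V, finrank ℝ F = k ∧ t = sInf (rayleighRange a b F)}

/-- `b ≥ c a` on some `k`-dimensional subspace: the superlevel sets of the max-min values. -/
def DominatesOnDim (a b : LinearMap.BilinForm ℝ V) (c : ℝ) (k : ℕ) : Prop :=
  ∃ F : Submodule ℝ V, finrank ℝ F = k ∧ ∀ v ∈ F, c * a v v ≤ b v v

/-- `b` is form-bounded relative to `a`. -/
def IsFormBounded (a b : LinearMap.BilinForm ℝ V) : Prop :=
  ∃ B : ℝ, ∀ v, |b v v| ≤ B * a v v

/-- `b` is form-compact relative to `a`: it is arbitrarily small with respect to `a` on subspaces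
of finite codimension. -/
def IsFormCompact (a b : LinearMap.BilinForm ℝ V) : Prop :=
  ∀ ε : ℝ, 0 < ε → ∃ W : Submodule ℝ V, W.CoFG ∧ ∀ w ∈ W, |b w w| ≤ ε * a w w

theorem IsFormBounded.add (hb : IsFormBounded a b) (hd : IsFormBounded a d) :
    IsFormBounded a (b + d) := by
  obtain ⟨B, hB⟩ := hb
  obtain ⟨D, hD⟩ := hd
  exact ⟨B + D, fun v => (abs_add_le _ _).trans (by linarith [hB v, hD v])⟩

theorem IsFormBounded.smul (hb : IsFormBounded a b) (t : ℝ) : IsFormBounded a (t • b) := by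
  obtain ⟨B, hB⟩ := hb
  refine ⟨|t| * B, fun v => ?_⟩
  calc |t * b v v| = |t| * |b v v| := abs_mul _ _
    _ ≤ |t| * B * a v v := by rw [mul_assoc]; gcongr; exact hB v

theorem exists_sq_mul_apply_self_eq_one (ha : a.toQuadraticMap.PosDef) {v : V} (hv : v ≠ 0) :
    ∃ r : ℝ, r ^ 2 * a v v = 1 := by
  have hpos : 0 < a v v := ha v hv
  exact ⟨(√(a v v))⁻¹, by rw [inv_pow, Real.sq_sqrt hpos.le, inv_mul_cancel₀ hpos.ne']⟩

theorem apply_smul_smul_self (b : LinearMap.BilinForm ℝ V) (r : ℝ) (v : V) :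
    b (r • v) (r • v) = r ^ 2 * b v v := by
  simp only [map_smul, LinearMap.smul_apply, smul_eq_mul]
  ring

theorem rayleighRange_nonempty (ha : a.toQuadraticMap.PosDef) (b : LinearMap.BilinForm ℝ V)
    {F : Submodule ℝ V} (hF : 0 < finrank ℝ F) : (rayleighRange a b F).Nonempty := by
  have : Nontrivial F := nontrivial_of_finrank_pos hF
  obtain ⟨v, hvF, hv⟩ := F.exists_mem_ne_zero_of_ne_bot (F.nontrivial_iff_ne_bot.1 this)
  obtain ⟨r, hr⟩ := exists_sq_mul_apply_self_eq_one ha hv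
  exact ⟨_, r • v, ⟨F.smul_mem r hvF, (apply_smul_smul_self a r v).trans hr⟩, rfl⟩

theorem le_sInf_rayleighRange_iff (ha : a.toQuadraticMap.PosDef) (hb : IsFormBounded a b)
    {F : Submodule ℝ V} (hF : 0 < finrank ℝ F) {c : ℝ} :
    c ≤ sInf (rayleighRange a b F) ↔ ∀ v ∈ F, c * a v v ≤ b v v := by
  have hbdd : BddBelow (rayleighRange a b F) := by
    obtain ⟨B, hB⟩ := hb
    refine ⟨-B, ?_⟩
    rintro _ ⟨v, ⟨-, hv⟩, rfl⟩
    simpa [hv] using neg_le_of_abs_le (hB v)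
  rw [le_csInf_iff hbdd (rayleighRange_nonempty ha b hF)]
  refine ⟨fun h v hvF => ?_, ?_⟩
  · rcases eq_or_ne v 0 with rfl | hv
    · simp
    obtain ⟨r, hr⟩ := exists_sq_mul_apply_self_eq_one ha hv
    have hc : c ≤ r ^ 2 * b v v := h _ ⟨r • v, ⟨F.smul_mem r hvF,
      (apply_smul_smul_self a r v).trans hr⟩, apply_smul_smul_self b r v⟩
    calc c * a v v ≤ r ^ 2 * b v v * a v v := mul_le_mul_of_nonneg_right hc (ha.nonneg v)
      _ = r ^ 2 * a v v * b v v := by ring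
      _ = b v v := by rw [hr, one_mul]
  · rintro h _ ⟨v, ⟨hvF, hv⟩, rfl⟩
    simpa [hv] using h v hvF

theorem isLUB_maxMin (ha : a.toQuadraticMap.PosDef) (hb : IsFormBounded a b) {k : ℕ}
    (hk : 0 < k) (hV : ∃ F : Submodule ℝ V, finrank ℝ F = k) :
    IsLUB {c | DominatesOnDim a b c k} (maxMin a b k) := by
  have hlub : IsLUB {t | ∃ F : Submodule ℝ V, finrank ℝ F = k ∧ t = sInf (rayleighRange a b F)}
      (maxMin a b k) := by
    obtain ⟨F, hF⟩ := hV
    obtain ⟨B, hB⟩ := id hb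
    refine isLUB_csSup ⟨_, F, hF, rfl⟩ ⟨B, ?_⟩
    rintro _ ⟨F, rfl, rfl⟩
    obtain ⟨_, v, ⟨hvF, hv⟩, -⟩ := rayleighRange_nonempty ha b hk
    have hle := (le_sInf_rayleighRange_iff ha hb hk).1 le_rfl v hvF
    simpa [hv] using hle.trans ((le_abs_self _).trans (hB v))
  constructor
  · rintro c ⟨F, rfl, hc⟩
    exact ((le_sInf_rayleighRange_iff ha hb hk).2 hc).trans (hlub.1 ⟨F, rfl, rfl⟩)
  · refine fun M hM => hlub.2 ?_
    rintro _ ⟨F, rfl, rfl⟩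
    exact hM ⟨F, rfl, (le_sInf_rayleighRange_iff ha hb hk).1 le_rfl⟩

theorem maxMin_le_maxMin_add (ha : a.toQuadraticMap.PosDef) (hb : IsFormBounded a b)
    (hd : IsFormBounded a d) {D : ℝ} (h : ∀ v, b v v ≤ d v v + D * a v v) {k : ℕ} (hk : 0 < k)
    (hV : ∃ F : Submodule ℝ V, finrank ℝ F = k) : maxMin a b k ≤ maxMin a d k + D := by
  refine (isLUB_maxMin ha hb hk hV).2 ?_
  rintro c ⟨F, hF, hc⟩
  have hdom : DominatesOnDim a d (c - D) k := ⟨F, hF, fun v hv => by linarith [hc v hv, h v]⟩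
  linarith [(isLUB_maxMin ha hd hk hV).1 hdom]

theorem IsFormCompact.exists_forall_dominatesOnDim_le (ha : a.toQuadraticMap.PosDef)
    (hb : IsFormCompact a b) {c : ℝ} (hc : 0 < c) :
    ∃ M, ∀ k, DominatesOnDim a b c k → k ≤ M := by
  obtain ⟨W, hWfg, hW⟩ := hb (c / 2) (half_pos hc)
  refine ⟨finrank ℝ (V ⧸ W), ?_⟩
  rintro _ ⟨F, rfl, hF⟩
  refine LinearMap.finrank_le_finrank_of_injective (f := W.mkQ.domRestrict F) ?_
  rw [← LinearMap.ker_eq_bot, LinearMap.ker_eq_bot']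
  rintro ⟨v, hvF⟩ hv
  have hvW : v ∈ W := (Submodule.Quotient.mk_eq_zero W).1 hv
  by_contra hne
  have hpos : 0 < a v v := ha v fun h => hne (Subtype.ext h)
  linarith [hF v hvF, (le_abs_self _).trans (hW v hvW), mul_pos hc hpos]

theorem DominatesOnDim.one_of_eigenvector {c : ℝ} {u : V} (hu0 : u ≠ 0)
    (hu : b u u = c * a u u) : DominatesOnDim a b c 1 := by
  refine ⟨Submodule.span ℝ {u}, finrank_span_singleton hu0, fun v hv => ?_⟩
  obtain ⟨r, rfl⟩ := Submodule.mem_span_singleton.1 hv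
  rw [apply_smul_smul_self, apply_smul_smul_self, hu, mul_left_comm]

/- The eigenvector `u` is `(b - c a)`-orthogonal to everything, and it lies outside the subspace
because there `b ≥ c' a > c a`. -/
theorem DominatesOnDim.succ_of_eigenvector (ha : a.toQuadraticMap.PosDef) (ha' : a.IsSymm)
    (hb' : b.IsSymm) {c c' : ℝ} (hcc' : c < c') {k : ℕ} (hk : 0 < k)
    (h : DominatesOnDim a b c' k) {u : V} (hu0 : u ≠ 0) (hu : ∀ v, b u v = c * a u v) :
    DominatesOnDim a b c (k + 1) := by
  obtain ⟨F, rfl, hF⟩ := h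
  have : Module.Finite ℝ F := finite_of_finrank_pos hk
  have huF : u ∉ F := fun huF => by
    have hle := hF u huF
    rw [hu u] at hle
    exact hcc'.not_ge (le_of_mul_le_mul_right hle (ha u hu0))
  refine ⟨F ⊔ Submodule.span ℝ {u}, ?_, fun w hw => ?_⟩
  · have hdim := Submodule.finrank_sup_add_finrank_inf_eq F (Submodule.span ℝ {u})
    have hinf : F ⊓ Submodule.span ℝ {u} = ⊥ :=
      disjoint_iff.1 ((Submodule.disjoint_span_singleton' hu0).2 huF)
    rwa [hinf, finrank_bot, add_zero, finrank_span_singleton hu0] at hdim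
  · obtain ⟨v, hv, z, hz, rfl⟩ := Submodule.mem_sup.1 hw
    obtain ⟨r, rfl⟩ := Submodule.mem_span_singleton.1 hz
    have hvF : c * a v v ≤ b v v :=
      (mul_le_mul_of_nonneg_right hcc'.le (ha.nonneg v)).trans (hF v hv)
    simp only [map_add, map_smul, LinearMap.add_apply, LinearMap.smul_apply, smul_eq_mul,
      hb'.eq v u, ha'.eq v u, hu]
    linarith

theorem maxMin_eq_of_not_dominatesOnDim_succ (ha : a.toQuadraticMap.PosDef) (ha' : a.IsSymm)
    (hb : IsFormBounded a b) (hb' : b.IsSymm) {c : ℝ} {k : ℕ} (hk : 0 < k) {u : V} (hu0 : u ≠ 0)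
    (hu : ∀ v, b u v = c * a u v) (hdom : DominatesOnDim a b c k)
    (hsucc : ¬ DominatesOnDim a b c (k + 1)) : maxMin a b k = c := by
  have hlub := isLUB_maxMin ha hb hk (hdom.imp fun _ h => h.1)
  refine le_antisymm (hlub.2 fun c' hc' => le_of_not_gt fun hcc' => hsucc ?_) (hlub.1 hdom)
  exact hc'.succ_of_eigenvector ha ha' hb' hcc' hk hu0 hu

theorem exists_dominatesOnDim_not_succ {β : ℝ → LinearMap.BilinForm ℝ V} {c : ℝ}
    (hone : ∀ t, 0 < t → DominatesOnDim a (β t) c 1)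
    (hbdd : ∃ t, 0 < t ∧ ∃ M, ∀ k, DominatesOnDim a (β t) c k → k ≤ M) :
    ∃ k, 0 < k ∧ (∀ t, 0 < t → DominatesOnDim a (β t) c k) ∧
      ∃ t, 0 < t ∧ ¬ DominatesOnDim a (β t) c (k + 1) := by
  obtain ⟨s, hs, M, hM⟩ := hbdd
  by_contra! hsucc
  have hall : ∀ k, 1 ≤ k → ∀ t, 0 < t → DominatesOnDim a (β t) c k := fun k hk =>
    Nat.le_induction hone (fun k hk ih => hsucc k hk ih) k hk
  have := hM (M + 1) (hall (M + 1) (by omega) s hs)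
  omega

theorem exists_maxMin_add_smul_eq (ha : a.toQuadraticMap.PosDef) (ha' : a.IsSymm)
    (hb : IsFormBounded a b) (hb' : b.IsSymm) (hd : IsFormBounded a d) (hd' : d.IsPosSemidef)
    (hbd : IsFormCompact a (b + d)) {c : ℝ} (hc : 0 < c) {u : V} (hu0 : u ≠ 0)
    (hbu : ∀ v, b u v = c * a u v) (hdu : ∀ v, d u v = 0) :
    ∃ t : ℝ, 0 < t ∧ ∃ k, 0 < k ∧ maxMin a b k = maxMin a (b + t • d) k := by
  have hbt (t : ℝ) : IsFormBounded a (b + t • d) := hb.add (hd.smul t)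
  have hut (t : ℝ) (v : V) : (b + t • d) u v = c * a u v := by simp [hbu, hdu]
  obtain ⟨k, hk, hall, t, ht, hsucc⟩ :=
    exists_dominatesOnDim_not_succ (a := a) (β := fun t => b + t • d) (c := c)
      (fun t _ => .one_of_eigenvector hu0 (hut t u))
      ⟨1, one_pos, by simpa using hbd.exists_forall_dominatesOnDim_le ha hc⟩
  have hV : ∃ F : Submodule ℝ V, finrank ℝ F = k := (hall t ht).imp fun _ h => h.1
  have hct : maxMin a (b + t • d) k = c :=
    maxMin_eq_of_not_dominatesOnDim_succ ha ha' (hbt t) (hb'.add (hd'.isSymm.smul t)) hk hu0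
      (hut t) (hall t ht) hsucc
  refine ⟨t, ht, k, hk, le_antisymm ?_ (hct.trans_le ?_)⟩
  · have hle (v : V) : b v v ≤ (b + t • d) v v + 0 * a v v := by
      simpa using mul_nonneg ht.le (hd'.nonneg v)
    simpa using maxMin_le_maxMin_add ha hb (hbt t) hle hk hV
  obtain ⟨D, hD⟩ := hd
  have hclose (τ : ℝ) (hτ : 0 < τ) : c ≤ maxMin a b k + τ * D := by
    have hle (v : V) : (b + τ • d) v v ≤ b v v + τ * D * a v v := by
      have := mul_le_mul_of_nonneg_left ((le_abs_self _).trans (hD v)) hτ.le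
      simpa [mul_assoc] using this
    exact ((isLUB_maxMin ha (hbt τ) hk hV).1 (hall τ hτ)).trans
      (maxMin_le_maxMin_add ha (hbt τ) hb hle hk hV)
  have hlim : Filter.Tendsto (fun τ : ℝ => maxMin a b k + τ * D) (𝓝[>] 0) (𝓝 (maxMin a b k)) := by
    have hcont : Continuous fun τ : ℝ => maxMin a b k + τ * D := by fun_prop
    exact (hcont.tendsto' 0 _ (by simp)).mono_left nhdsWithin_le_nhds
  exact ge_of_tendsto hlim (Filter.eventually_of_mem self_mem_nhdsWithin hclose)

end MaxMin

section DoubleIntegral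

variable {X : Type*} [MeasurableSpace X] {μ : Measure X} [IsFiniteMeasure μ] {f : X → ℝ}

theorem integral_prod_sub_sq (hf : MemLp f 2 μ) :
    ∫ p, (f p.1 - f p.2) ^ 2 ∂μ.prod μ =
      2 * (μ.real univ * ∫ x, f x ^ 2 ∂μ - (∫ x, f x ∂μ) ^ 2) := by
  have hf₁ : Integrable f μ := hf.integrable one_le_two
  have hone : Integrable (fun _ : X => (1 : ℝ)) μ := integrable_const 1
  have hleft := hf.integrable_sq.mul_prod hone
  have hmixed := (hf₁.mul_prod hf₁).const_mul 2
  have hright := hone.mul_prod hf.integrable_sq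
  have hsub : Integrable (fun p : X × X => f p.1 ^ 2 * 1 - 2 * (f p.1 * f p.2)) (μ.prod μ) :=
    hleft.sub hmixed
  calc ∫ p, (f p.1 - f p.2) ^ 2 ∂μ.prod μ
      = ∫ p, (f p.1 ^ 2 * 1 - 2 * (f p.1 * f p.2) + 1 * f p.2 ^ 2) ∂μ.prod μ :=
        integral_congr_ae (ae_of_all _ fun p => by ring)
    _ = (∫ x, f x ^ 2 ∂μ) * (∫ _, 1 ∂μ) - 2 * ((∫ x, f x ∂μ) * ∫ x, f x ∂μ) +
          (∫ _, 1 ∂μ) * ∫ x, f x ^ 2 ∂μ := by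
        rw [integral_add hsub hright, integral_sub hleft hmixed, integral_const_mul,
          integral_prod_mul (fun x => f x ^ 2) (fun _ => (1 : ℝ)), integral_prod_mul f f,
          integral_prod_mul (fun _ => (1 : ℝ)) (fun x => f x ^ 2)]
    _ = 2 * (μ.real univ * ∫ x, f x ^ 2 ∂μ - (∫ x, f x ∂μ) ^ 2) := by
        simp only [integral_const, smul_eq_mul, mul_one]
        ring

theorem sq_integral_le (hf : MemLp f 2 μ) :
    (∫ x, f x ∂μ) ^ 2 ≤ μ.real univ * ∫ x, f x ^ 2 ∂μ := by
  have hnonneg : 0 ≤ ∫ p, (f p.1 - f p.2) ^ 2 ∂μ.prod μ := integral_nonneg fun p => sq_nonneg _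
  linarith [integral_prod_sub_sq hf]

theorem measureReal_mul_integral_sq_le {Ω : Set X} (hf : MemLp f 2 μ)
    (hf₀ : ∀ᵐ x ∂μ, x ∉ Ω → f x = 0)
    (h : ∫ x, f x ∂μ = 0 ∨ 2 * μ.real Ω ≤ μ.real univ) :
    μ.real univ * ∫ x, f x ^ 2 ∂μ ≤ ∫ p, (f p.1 - f p.2) ^ 2 ∂μ.prod μ := by
  have hsq : 0 ≤ ∫ x, f x ^ 2 ∂μ := integral_nonneg fun x => sq_nonneg _
  suffices 2 * (∫ x, f x ∂μ) ^ 2 ≤ μ.real univ * ∫ x, f x ^ 2 ∂μ by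
    linarith [integral_prod_sub_sq hf]
  rcases h with h | h
  · simpa [h] using mul_nonneg measureReal_nonneg hsq
  calc 2 * (∫ x, f x ∂μ) ^ 2 = 2 * (∫ x in Ω, f x ∂μ) ^ 2 := by
        rw [setIntegral_eq_integral_of_ae_compl_eq_zero hf₀]
    _ ≤ 2 * (μ.real Ω * ∫ x in Ω, f x ^ 2 ∂μ) := by
        have := sq_integral_le (hf.restrict Ω)
        rw [measureReal_restrict_apply_univ] at this
        linarith
    _ = 2 * μ.real Ω * ∫ x, f x ^ 2 ∂μ := by
        rw [setIntegral_eq_integral_of_ae_compl_eq_zero, mul_assoc]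
        filter_upwards [hf₀] with x hx hxΩ
        rw [hx hxΩ, zero_pow two_ne_zero]
    _ ≤ μ.real univ * ∫ x, f x ^ 2 ∂μ := by gcongr

end DoubleIntegral

section Cubes

variable {N : ℕ} {δ : ℝ}

/-- The half-open cubes of side `δ` of the lattice `δ ℤ^N`. -/
def cube (N : ℕ) (δ : ℝ) (k : Fin N → ℤ) : Set (Space N) := {x | ∀ i, ⌊x i / δ⌋ = k i}

theorem cube_eq_preimage (hδ : 0 < δ) (k : Fin N → ℤ) :
    cube N δ k = WithLp.ofLp ⁻¹' (univ.pi fun i => Ico (k i * δ) ((k i + 1) * δ)) := by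
  ext x
  simp only [cube, mem_ofPred_eq, mem_preimage, mem_pi, mem_univ, true_imp_iff, mem_Ico]
  refine forall_congr' fun i => ?_
  rw [Int.floor_eq_iff, le_div_iff₀ hδ, div_lt_iff₀ hδ]

theorem measurableSet_cube (hδ : 0 < δ) (k : Fin N → ℤ) : MeasurableSet (cube N δ k) := by
  rw [cube_eq_preimage hδ]
  exact (PiLp.volume_preserving_ofLp (Fin N)).measurable
    (MeasurableSet.univ_pi fun i => measurableSet_Ico)

theorem volume_cube (hδ : 0 < δ) (k : Fin N → ℤ) :
    volume (cube N δ k) = ENNReal.ofReal (δ ^ N) := by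
  have hside (i : Fin N) : ((k i : ℝ) + 1) * δ - k i * δ = δ := by ring
  rw [cube_eq_preimage hδ, (PiLp.volume_preserving_ofLp (Fin N)).measure_preimage
    (MeasurableSet.univ_pi fun i => measurableSet_Ico).nullMeasurableSet, Real.volume_pi_Ico]
  simp only [hside, Finset.prod_const, Finset.card_univ, Fintype.card_fin,
    ENNReal.ofReal_pow hδ.le]

theorem pairwise_disjoint_cube (N : ℕ) (δ : ℝ) : Pairwise (Function.onFun Disjoint (cube N δ)) :=
  fun _ _ hkl => Set.disjoint_left.2 fun _ hk hl =>
    hkl (funext fun i => (hk i).symm.trans (hl i))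

theorem iUnion_cube (N : ℕ) (δ : ℝ) : ⋃ k, cube N δ k = univ :=
  eq_univ_of_forall fun x => mem_iUnion.2 ⟨fun i => ⌊x i / δ⌋, fun _ => rfl⟩

theorem norm_sub_le_of_mem_cube (hδ : 0 < δ) {k : Fin N → ℤ} {x y : Space N}
    (hx : x ∈ cube N δ k) (hy : y ∈ cube N δ k) : ‖x - y‖ ≤ √N * δ := by
  rw [cube_eq_preimage hδ] at hx hy
  simp only [mem_preimage, mem_pi, mem_univ, true_imp_iff, mem_Ico] at hx hy
  rw [EuclideanSpace.norm_eq, Real.sqrt_le_left (by positivity), mul_pow,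
    Real.sq_sqrt (Nat.cast_nonneg N)]
  calc ∑ i, ‖(x - y) i‖ ^ 2 ≤ ∑ _i : Fin N, δ ^ 2 := by
        refine Finset.sum_le_sum fun i _ => ?_
        rw [Real.norm_eq_abs, sq_abs, PiLp.sub_apply]
        refine sq_le_sq' ?_ ?_ <;> linarith [(hx i).1, (hx i).2, (hy i).1, (hy i).2]
    _ = N * δ ^ 2 := by simp

end Cubes

section CubewisePoincare

variable {N : ℕ} {Ω : Set (Space N)} {K f : Space N → ℝ} {α s δ : ℝ}

theorem energyDensity_self_nonneg (hK : IsKernel K) (f : Space N → ℝ) (p : Space N × Space N) :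
    0 ≤ energyDensity K f f p := by
  by_cases h : p.1 - p.2 = 0
  · simp [energyDensity, sub_eq_zero.1 h]
  · exact mul_nonneg (mul_self_nonneg _) (hK.pos _ h).le

theorem sq_sub_le_energyDensity {q d : ℝ} (hα : 0 < α) (hq : 0 ≤ q)
    (hlow : ∀ x, x ≠ 0 → α * ‖x‖ ^ (-q) ≤ K x) (f : Space N → ℝ) {p : Space N × Space N}
    (hp : ‖p.1 - p.2‖ ≤ d) :
    (f p.1 - f p.2) ^ 2 ≤ d ^ q / α * energyDensity K f f p := by
  by_cases h : p.1 - p.2 = 0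
  · simp [energyDensity, sub_eq_zero.1 h]
  have hnorm : 0 < ‖p.1 - p.2‖ := norm_pos_iff.2 h
  have hd : 0 < d := hnorm.trans_le hp
  have hkernel : 1 ≤ d ^ q / α * K (p.1 - p.2) :=
    calc 1 = d ^ q / α * (α * d ^ (-q)) := by
          have := (Real.rpow_pos_of_pos hd q).ne'
          rw [Real.rpow_neg hd.le]
          field_simp
      _ ≤ d ^ q / α * (α * ‖p.1 - p.2‖ ^ (-q)) := by
          have := Real.rpow_le_rpow_of_nonpos hnorm hp (neg_nonpos.2 hq)
          gcongr
      _ ≤ d ^ q / α * K (p.1 - p.2) := by gcongr; exact hlow _ h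
  calc (f p.1 - f p.2) ^ 2 ≤ (f p.1 - f p.2) ^ 2 * (d ^ q / α * K (p.1 - p.2)) :=
        le_mul_of_one_le_right (sq_nonneg _) hkernel
    _ = d ^ q / α * energyDensity K f f p := by
        rw [energyDensity]
        ring

theorem setIntegral_sq_le_of_cube (hα : 0 < α) (hs : 0 < s)
    (hlow : ∀ x, x ≠ 0 → α * ‖x‖ ^ (-((N : ℝ) + 2 * s)) ≤ K x) (hδ : 0 < δ)
    (hf : MemLp f 2 volume) (hfE : FiniteEnergy K f)
    (hf₀ : ∀ᵐ x, x ∉ Ω → f x = 0) {k : Fin N → ℤ}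
    (hk : ∫ x in cube N δ k, f x = 0 ∨ 2 * volume.real (Ω ∩ cube N δ k) ≤ δ ^ N) :
    ∫ x in cube N δ k, f x ^ 2 ≤ √N ^ ((N : ℝ) + 2 * s) / α * δ ^ (2 * s) *
      ∫ p in cube N δ k ×ˢ cube N δ k, energyDensity K f f p := by
  have hvol : volume.real (cube N δ k) = δ ^ N := by
    rw [measureReal_def, volume_cube hδ, ENNReal.toReal_ofReal (by positivity)]
  have : IsFiniteMeasure (volume.restrict (cube N δ k)) :=
    isFiniteMeasure_restrict.2 (by rw [volume_cube hδ]; exact ENNReal.ofReal_ne_top)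
  have hdiff : δ ^ N * ∫ x in cube N δ k, f x ^ 2 ≤
      ∫ p in cube N δ k ×ˢ cube N δ k, (f p.1 - f p.2) ^ 2 := by
    have := measureReal_mul_integral_sq_le (hf.restrict (cube N δ k)) (ae_restrict_of_ae hf₀)
      (by rwa [measureReal_restrict_apply_univ,
        measureReal_restrict_apply' (measurableSet_cube hδ k), hvol])
    rwa [measureReal_restrict_apply_univ, hvol, Measure.prod_restrict] at this
  have henergy : ∫ p in cube N δ k ×ˢ cube N δ k, (f p.1 - f p.2) ^ 2 ≤
      ∫ p in cube N δ k ×ˢ cube N δ k,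
        (√N * δ) ^ ((N : ℝ) + 2 * s) / α * energyDensity K f f p := by
    refine integral_mono_of_nonneg (ae_of_all _ fun p => sq_nonneg _)
      (hfE.restrict.const_mul _) ?_
    filter_upwards [ae_restrict_mem ((measurableSet_cube hδ k).prod (measurableSet_cube hδ k))]
      with p hp
    exact sq_sub_le_energyDensity hα (by positivity) hlow f
      (norm_sub_le_of_mem_cube hδ hp.1 hp.2)
  refine le_of_mul_le_mul_left ((hdiff.trans henergy).trans_eq ?_) (pow_pos hδ N)
  rw [integral_const_mul, Real.mul_rpow (by positivity) hδ.le, Real.rpow_add hδ,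
    Real.rpow_natCast]
  ring

theorem integral_sq_le_of_cubes (hK : IsKernel K) (hα : 0 < α) (hs : 0 < s)
    (hlow : ∀ x, x ≠ 0 → α * ‖x‖ ^ (-((N : ℝ) + 2 * s)) ≤ K x) (hδ : 0 < δ)
    (hf : MemLp f 2 volume) (hfE : FiniteEnergy K f)
    (hf₀ : ∀ᵐ x, x ∉ Ω → f x = 0)
    (hcubes : ∀ k, ∫ x in cube N δ k, f x = 0 ∨ 2 * volume.real (Ω ∩ cube N δ k) ≤ δ ^ N) :
    ∫ x, f x ^ 2 ≤
      √N ^ ((N : ℝ) + 2 * s) / α * δ ^ (2 * s) * ∫ p, energyDensity K f f p := by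
  have hleft : HasSum (fun k => ∫ x in cube N δ k, f x ^ 2) (∫ x, f x ^ 2) := by
    simpa [iUnion_cube] using hasSum_integral_iUnion (measurableSet_cube hδ)
      (pairwise_disjoint_cube N δ) hf.integrable_sq.integrableOn
  have hright : HasSum (fun k => ∫ p in cube N δ k ×ˢ cube N δ k, energyDensity K f f p)
      (∫ p in ⋃ k, cube N δ k ×ˢ cube N δ k, energyDensity K f f p) :=
    hasSum_integral_iUnion
      (fun k => (measurableSet_cube hδ k).prod (measurableSet_cube hδ k))
      (fun _ _ hkl => Set.disjoint_prod.2 (Or.inl (pairwise_disjoint_cube N δ hkl)))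
      hfE.integrableOn
  refine (hasSum_le (fun k => setIntegral_sq_le_of_cube hα hs hlow hδ hf hfE hf₀ (hcubes k))
    hleft (hright.mul_left _)).trans ?_
  exact mul_le_mul_of_nonneg_left
    (setIntegral_le_integral hfE (ae_of_all _ (energyDensity_self_nonneg hK f))) (by positivity)

end CubewisePoincare

section Lp

variable {X : Type*} [MeasurableSpace X] {μ : Measure X}

theorem ae_norm_apply_le_norm {E : Type*} [NormedAddCommGroup E] (f : Lp E ∞ μ) :
    ∀ᵐ x ∂μ, ‖f x‖ ≤ ‖f‖ := by
  have hfin : eLpNormEssSup f μ ≠ ∞ := by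
    rw [← eLpNorm_exponent_top]
    exact (Lp.memLp f).eLpNorm_ne_top
  filter_upwards [ae_le_eLpNormEssSup (f := f) (μ := μ)] with x hx
  rw [Lp.norm_def, eLpNorm_exponent_top]
  simpa using ENNReal.toReal_mono hfin hx

theorem lp_smul_pos {p : ℝ≥0∞} {c : ℝ} (hc : 0 < c) {f : Lp ℝ p μ} (hf : 0 < f) : 0 < c • f := by
  refine lt_of_le_of_ne ((Lp.coeFn_nonneg _).1 ?_) (smul_ne_zero hc.ne' hf.ne').symm
  filter_upwards [Lp.coeFn_smul c f, (Lp.coeFn_nonneg f).2 hf.le] with x hx hfx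
  rw [hx]
  exact mul_nonneg hc.le hfx

end Lp

section Forms

variable {N : ℕ} {Ω : Set (Space N)} {K : Space N → ℝ} {hK : IsKernel K}

theorem XK.memLp (u : XK Ω hK) : MemLp u.1 2 volume :=
  Lp.memLp u.1

theorem XK.ae_eq_zero (u : XK Ω hK) : ∀ᵐ x, x ∉ Ω → u.1 x = 0 :=
  ae_imp_of_ae_restrict u.2.2

theorem XK.coeFn_add (u v : XK Ω hK) : (u + v).1 =ᵐ[volume] ⇑u.1 + ⇑v.1 :=
  Lp.coeFn_add u.1 v.1

theorem XK.coeFn_smul (c : ℝ) (u : XK Ω hK) : (c • u).1 =ᵐ[volume] c • ⇑u.1 :=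
  Lp.coeFn_smul c u.1

theorem XK.integrable_energyDensity (u v : XK Ω hK) :
    Integrable (energyDensity K u.1 v.1) := by
  have hadd := FiniteEnergy.add hK (XK.memLp u).1 (XK.memLp v).1 u.2.1 v.2.1
  refine (((Integrable.sub hadd u.2.1).sub v.2.1).const_mul 2⁻¹).congr (ae_of_all _ fun p => ?_)
  simp only [energyDensity, Pi.add_apply, Pi.sub_apply]
  ring

theorem innerK_comm (u v : XK Ω hK) : innerK u v = innerK v u := by
  refine integral_congr_ae (ae_of_all _ fun p => ?_)
  simp only [energyDensity]
  ring

theorem innerK_add_left (u v w : XK Ω hK) : innerK (u + v) w = innerK u w + innerK v w := by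
  rw [innerK, innerK, innerK,
    ← integral_add (XK.integrable_energyDensity u w) (XK.integrable_energyDensity v w)]
  refine integral_congr_ae
    ((energyDensity_congr K (XK.coeFn_add u v) ae_eq_rfl).trans (ae_of_all _ fun p => ?_))
  simp only [energyDensity, Pi.add_apply]
  ring

theorem innerK_smul_left (c : ℝ) (u w : XK Ω hK) : innerK (c • u) w = c * innerK u w := by
  rw [innerK, innerK, ← integral_const_mul]
  refine integral_congr_ae
    ((energyDensity_congr K (XK.coeFn_smul c u) ae_eq_rfl).trans (ae_of_all _ fun p => ?_))
  simp only [energyDensity, Pi.smul_apply, smul_eq_mul]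
  ring

theorem integrable_weight_mul (ρ : Weight Ω) (u v : XK Ω hK) :
    Integrable (fun x => ρ x * u.1 x * v.1 x)
      (volume.restrict Ω) := by
  simp only [mul_assoc]
  exact ((XK.memLp u).integrable_mul (XK.memLp v)).restrict.bdd_mul (Lp.aestronglyMeasurable ρ)
    (ae_norm_apply_le_norm ρ)

theorem weightForm_comm (ρ : Weight Ω) (u v : XK Ω hK) :
    weightForm ρ u v = weightForm ρ v u :=
  integral_congr_ae (ae_of_all _ fun _ => mul_right_comm _ _ _)

theorem weightForm_add_left (ρ : Weight Ω) (u v w : XK Ω hK) :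
    weightForm ρ (u + v) w = weightForm ρ u w + weightForm ρ v w := by
  rw [weightForm, weightForm, weightForm,
    ← integral_add (integrable_weight_mul ρ u w) (integrable_weight_mul ρ v w)]
  refine integral_congr_ae ?_
  filter_upwards [ae_restrict_of_ae (XK.coeFn_add u v)] with x hx
  rw [hx, Pi.add_apply]
  ring

theorem weightForm_smul_left (ρ : Weight Ω) (c : ℝ) (u w : XK Ω hK) :
    weightForm ρ (c • u) w = c * weightForm ρ u w := by
  rw [weightForm, weightForm, ← integral_const_mul]
  refine integral_congr_ae ?_
  filter_upwards [ae_restrict_of_ae (XK.coeFn_smul c u)] with x hx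
  rw [hx, Pi.smul_apply, smul_eq_mul]
  ring

theorem weightForm_add_weight (ρ σ : Weight Ω) (u v : XK Ω hK) :
    weightForm (ρ + σ) u v = weightForm ρ u v + weightForm σ u v := by
  rw [weightForm, weightForm, weightForm,
    ← integral_add (integrable_weight_mul ρ u v) (integrable_weight_mul σ u v)]
  refine integral_congr_ae ?_
  filter_upwards [Lp.coeFn_add ρ σ] with x hx
  rw [hx, Pi.add_apply]
  ring

theorem weightForm_smul_weight (c : ℝ) (ρ : Weight Ω) (u v : XK Ω hK) :
    weightForm (c • ρ) u v = c * weightForm ρ u v := by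
  rw [weightForm, weightForm, ← integral_const_mul]
  refine integral_congr_ae ?_
  filter_upwards [Lp.coeFn_smul c ρ] with x hx
  rw [hx, Pi.smul_apply, smul_eq_mul]
  ring

theorem weightForm_neg_weight (ρ : Weight Ω) (u v : XK Ω hK) :
    weightForm (-ρ) u v = -weightForm ρ u v := by
  rw [← neg_one_smul ℝ ρ, weightForm_smul_weight, neg_one_mul]

theorem weightForm_self_nonneg {ρ : Weight Ω} (hρ : 0 ≤ ρ) (u : XK Ω hK) :
    0 ≤ weightForm ρ u u := by
  refine integral_nonneg_of_ae ?_
  filter_upwards [(Lp.coeFn_nonneg ρ).2 hρ] with x hx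
  rw [mul_assoc]
  exact mul_nonneg hx (mul_self_nonneg _)

theorem abs_weightForm_self_le (ρ : Weight Ω) (u : XK Ω hK) :
    |weightForm ρ u u| ≤ ‖ρ‖ * ∫ x, u.1 x ^ 2 :=
  calc |weightForm ρ u u| ≤ ∫ x in Ω, ‖ρ‖ * u.1 x ^ 2 := by
        rw [← Real.norm_eq_abs]
        refine norm_integral_le_of_norm_le ((XK.memLp u).integrable_sq.restrict.const_mul _) ?_
        filter_upwards [ae_norm_apply_le_norm ρ] with x hx
        rw [mul_assoc, ← sq, norm_mul, Real.norm_eq_abs (_ ^ 2), abs_sq]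
        gcongr
    _ ≤ ‖ρ‖ * ∫ x, u.1 x ^ 2 := by
        rw [integral_const_mul]
        exact mul_le_mul_of_nonneg_left (setIntegral_le_integral (XK.memLp u).integrable_sq
          (ae_of_all _ fun x => sq_nonneg _)) (norm_nonneg ρ)

/-- The scalar product `innerK` of `X_K(Ω)` as a bilinear form. -/
def energyForm (Ω : Set (Space N)) (hK : IsKernel K) : LinearMap.BilinForm ℝ (XK Ω hK) :=
  LinearMap.mk₂ ℝ innerK innerK_add_left innerK_smul_left
    (fun u v w => by simp only [innerK_comm u, innerK_add_left])
    (fun c u v => by simp only [innerK_comm u, innerK_smul_left, smul_eq_mul])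

/-- The form `weightForm ρ` on `X_K(Ω)` as a bilinear form. -/
def weightBilinForm (hK : IsKernel K) (ρ : Weight Ω) : LinearMap.BilinForm ℝ (XK Ω hK) :=
  LinearMap.mk₂ ℝ (weightForm ρ) (weightForm_add_left ρ) (weightForm_smul_left ρ)
    (fun u v w => by simp only [weightForm_comm ρ u, weightForm_add_left])
    (fun c u v => by simp only [weightForm_comm ρ u, weightForm_smul_left, smul_eq_mul])

theorem energyForm_isSymm : (energyForm Ω hK).IsSymm := ⟨innerK_comm⟩

theorem weightBilinForm_isSymm (ρ : Weight Ω) : (weightBilinForm hK ρ).IsSymm :=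
  ⟨weightForm_comm ρ⟩

theorem weightBilinForm_isPosSemidef {ρ : Weight Ω} (hρ : 0 ≤ ρ) :
    (weightBilinForm hK ρ).IsPosSemidef where
  isSymm := weightBilinForm_isSymm ρ
  isNonneg := ⟨weightForm_self_nonneg hρ⟩

theorem weightBilinForm_add (ρ σ : Weight Ω) :
    weightBilinForm hK (ρ + σ) = weightBilinForm hK ρ + weightBilinForm hK σ :=
  LinearMap.ext₂ (weightForm_add_weight ρ σ)

theorem weightBilinForm_smul (c : ℝ) (ρ : Weight Ω) :
    weightBilinForm hK (c • ρ) = c • weightBilinForm hK ρ :=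
  LinearMap.ext₂ (weightForm_smul_weight c ρ)

theorem exists_integral_sq_le (hΩ : volume Ω ≠ ∞) (hK : IsKernel K) :
    ∃ C : ℝ, ∀ u : XK Ω hK, ∫ x, u.1 x ^ 2 ≤ C * innerK u u := by
  obtain ⟨α, s, hα, hs, -, hN, hlow⟩ := hK.lower_bound
  have hN₀ : N ≠ 0 := by
    rintro rfl
    linarith [Nat.cast_zero (R := ℝ)]
  have hδ : 1 ≤ 2 * volume.real Ω + 1 := by linarith [measureReal_nonneg (μ := volume) (s := Ω)]
  refine ⟨_, fun u => integral_sq_le_of_cubes hK hα hs hlow (one_pos.trans_le hδ) (XK.memLp u) u.2.1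
    (XK.ae_eq_zero u) fun k => Or.inr ?_⟩
  calc 2 * volume.real (Ω ∩ cube N (2 * volume.real Ω + 1) k) ≤ 2 * volume.real Ω := by
        gcongr
        exact inter_subset_left
    _ ≤ 2 * volume.real Ω + 1 := by linarith
    _ ≤ (2 * volume.real Ω + 1) ^ N := le_self_pow₀ hδ hN₀

theorem finite_setOf_lt_measureReal_inter_cube (hΩ : volume Ω ≠ ∞) {δ c : ℝ} (hδ : 0 < δ)
    (hc : 0 < c) : {k | c < volume.real (Ω ∩ cube N δ k)}.Finite := by
  refine (Measure.finite_const_le_meas_of_disjoint_iUnion (volume.restrict Ω)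
    (ENNReal.ofReal_pos.2 hc) (measurableSet_cube hδ) (pairwise_disjoint_cube N δ) ?_).subset
    fun k hk => ?_
  · rw [iUnion_cube, Measure.restrict_apply_univ]
    exact hΩ
  · rw [mem_ofPred_eq, Measure.restrict_apply (measurableSet_cube hδ k), inter_comm]
    exact ENNReal.ofReal_le_of_le_toReal (le_of_lt hk)

theorem exists_coFG_setIntegral_eq_zero {ι : Type*} [Finite ι] {Q : ι → Set (Space N)}
    (hQ : ∀ i, MeasurableSet (Q i)) (hQ' : ∀ i, volume (Q i) ≠ ∞) :
    ∃ W : Submodule ℝ (XK Ω hK), W.CoFG ∧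
      ∀ u ∈ W, ∀ i, ∫ x in Q i, u.1 x = 0 := by
  let L : XK Ω hK →ₗ[ℝ] ι → ℝ := LinearMap.pi fun i =>
    innerₗ (Lp ℝ 2 (volume : Measure (Space N))) (indicatorConstLp 2 (hQ i) (hQ' i) 1) ∘ₗ
      (XK Ω hK).subtype
  refine ⟨LinearMap.ker L, Submodule.CoFG.ker L, fun u hu i => ?_⟩
  rw [← L2.inner_indicatorConstLp_one (𝕜 := ℝ) (hQ i) (hQ' i)]
  exact congrFun (LinearMap.mem_ker.1 hu) i

/- On cubes of small side the energy controls the variance of `u`. The mean is removed by a linear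
condition on the finitely many cubes mostly contained in `Ω`; on the others `u` vanishes on half
of the cube, so that no condition is needed. -/
theorem exists_coFG_integral_sq_le (hΩ : volume Ω ≠ ∞) (hK : IsKernel K) {ε : ℝ} (hε : 0 < ε) :
    ∃ W : Submodule ℝ (XK Ω hK), W.CoFG ∧
      ∀ u ∈ W, ∫ x, u.1 x ^ 2 ≤ ε * innerK u u := by
  obtain ⟨α, s, hα, hs, -, -, hlow⟩ := hK.lower_bound
  obtain ⟨δ, hδε, hδ⟩ : ∃ δ : ℝ, √N ^ ((N : ℝ) + 2 * s) / α * δ ^ (2 * s) < ε ∧ 0 < δ := by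
    have hcont : ContinuousAt (fun δ : ℝ => √N ^ ((N : ℝ) + 2 * s) / α * δ ^ (2 * s)) 0 :=
      (Real.continuousAt_rpow_const 0 (2 * s) (Or.inr (by positivity))).const_mul _
    have hlim := hcont.tendsto.mono_left (nhdsWithin_le_nhds (s := Ioi 0))
    rw [Real.zero_rpow (by positivity), mul_zero] at hlim
    exact ((hlim.eventually_lt_const hε).and self_mem_nhdsWithin).exists
  have hfin := finite_setOf_lt_measureReal_inter_cube hΩ hδ (half_pos (pow_pos hδ N))
  have := hfin.to_subtype
  obtain ⟨W, hWfg, hW⟩ := exists_coFG_setIntegral_eq_zero (Ω := Ω) (hK := hK)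
    (Q := fun k : {k : Fin N → ℤ | δ ^ N / 2 < volume.real (Ω ∩ cube N δ k)} => cube N δ k)
    (fun k => measurableSet_cube hδ k.1)
    (fun k => by rw [volume_cube hδ]; exact ENNReal.ofReal_ne_top)
  refine ⟨W, hWfg, fun u hu => (integral_sq_le_of_cubes hK hα hs hlow hδ (XK.memLp u) u.2.1
    (XK.ae_eq_zero u) fun k => ?_).trans ?_⟩
  · by_cases hk : δ ^ N / 2 < volume.real (Ω ∩ cube N δ k)
    · exact Or.inl (hW u hu ⟨k, hk⟩)
    · exact Or.inr (by linarith)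
  · exact mul_le_mul_of_nonneg_right hδε.le
      (integral_nonneg fun p => energyDensity_self_nonneg hK _ p)

theorem energyForm_posDef (hΩ : volume Ω ≠ ∞) : (energyForm Ω hK).toQuadraticMap.PosDef := by
  intro u hu
  obtain ⟨C, hC⟩ := exists_integral_sq_le hΩ hK
  have hnonneg : 0 ≤ innerK u u := integral_nonneg fun p => energyDensity_self_nonneg hK _ p
  refine hnonneg.lt_of_ne' fun h₀ => hu (Subtype.ext (Lp.ext ?_))
  have hsq : ∫ x, u.1 x ^ 2 = 0 :=
    le_antisymm (by simpa [h₀] using hC u) (integral_nonneg fun x => sq_nonneg _)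
  rw [integral_eq_zero_iff_of_nonneg (fun x => sq_nonneg _) (XK.memLp u).integrable_sq] at hsq
  filter_upwards [hsq, Lp.coeFn_zero ℝ 2 (volume : Measure (Space N))] with x hx hx₀
  exact (pow_eq_zero_iff two_ne_zero).1 hx |>.trans hx₀.symm

theorem isFormBounded_weightBilinForm (hΩ : volume Ω ≠ ∞) (ρ : Weight Ω) :
    IsFormBounded (energyForm Ω hK) (weightBilinForm hK ρ) := by
  obtain ⟨C, hC⟩ := exists_integral_sq_le hΩ hK
  refine ⟨‖ρ‖ * C, fun u => (abs_weightForm_self_le ρ u).trans ?_⟩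
  rw [mul_assoc]
  exact mul_le_mul_of_nonneg_left (hC u) (norm_nonneg ρ)

theorem isFormCompact_weightBilinForm (hΩ : volume Ω ≠ ∞) (ρ : Weight Ω) :
    IsFormCompact (energyForm Ω hK) (weightBilinForm hK ρ) := by
  intro ε hε
  have hρ : 0 < ‖ρ‖ + 1 := by positivity
  obtain ⟨W, hWfg, hW⟩ := exists_coFG_integral_sq_le hΩ hK (div_pos hε hρ)
  refine ⟨W, hWfg, fun u hu => ?_⟩
  calc |weightForm ρ u u| ≤ ‖ρ‖ * ∫ x, u.1 x ^ 2 := abs_weightForm_self_le ρ u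
    _ ≤ (‖ρ‖ + 1) * ∫ x, u.1 x ^ 2 := by
        gcongr
        linarith
    _ ≤ (‖ρ‖ + 1) * (ε / (‖ρ‖ + 1) * innerK u u) := by gcongr; exact hW u hu
    _ = ε * innerK u u := by rw [← mul_assoc, mul_div_cancel₀ ε hρ.ne']

end Forms

section Eigenvalues

variable {N : ℕ} {Ω : Set (Space N)} {K : Space N → ℝ} {hK : IsKernel K}

theorem supInf_eq_maxMin (ρ : Weight Ω) (k : ℕ) :
    supInf hK ρ k = maxMin (energyForm Ω hK) (weightBilinForm hK ρ) k := by
  have hunit (u : XK Ω hK) : normK u = 1 ↔ innerK u u = 1 := Real.sqrt_eq_one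
  have hrange (F : Submodule ℝ (XK Ω hK)) :
      rayleighValues ρ F = rayleighRange (energyForm Ω hK) (weightBilinForm hK ρ) F := by
    simp only [rayleighValues, hunit]
    rfl
  simp only [supInf, maxMin, hrange]

theorem posPart_ne_zero_of_weightForm_pos {ρ : Weight Ω} {u : XK Ω hK}
    (h : 0 < weightForm ρ u u) : ρ⁺ ≠ 0 := by
  intro h₀
  have hneg := weightForm_self_nonneg (neg_nonneg.2 (posPart_eq_zero.1 h₀)) u
  rw [weightForm_neg_weight] at hneg
  linarith

theorem exists_weight_supported_on_zeros (hΩ : volume Ω ≠ ∞) {u : XK Ω hK}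
    (hu : volume {x ∈ Ω | u.1 x = 0} ≠ 0) :
    ∃ χ : Weight Ω, 0 < χ ∧ ∀ v : XK Ω hK, weightForm χ u v = 0 := by
  have : IsFiniteMeasure (volume.restrict Ω) := isFiniteMeasure_restrict.2 hΩ
  let Z : Set (Space N) := {x | u.1 x = 0}
  have hZ : MeasurableSet Z :=
    (Lp.stronglyMeasurable u.1).measurable
      (measurableSet_singleton 0)
  have hZΩ : volume.restrict Ω Z ≠ 0 := by rwa [Measure.restrict_apply hZ, inter_comm]
  have hcoe := indicatorConstLp_coeFn (p := ∞) (hs := hZ)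
    (hμs := measure_ne_top (volume.restrict Ω) Z) (c := (1 : ℝ))
  refine ⟨indicatorConstLp ∞ hZ (measure_ne_top (volume.restrict Ω) Z) 1, ?_, fun v => ?_⟩
  · refine lt_of_le_of_ne ((Lp.coeFn_nonneg _).1 ?_) (Ne.symm (norm_ne_zero_iff.1 ?_))
    · filter_upwards [hcoe] with x hx
      rw [hx]
      exact indicator_nonneg (fun _ _ => zero_le_one) x
    · rw [norm_indicatorConstLp_top hZΩ, norm_one]
      exact one_ne_zero
  · refine integral_eq_zero_of_ae ?_
    filter_upwards [hcoe] with x hx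
    by_cases hxZ : x ∈ Z
    · rw [show u.1 x = 0 from hxZ, mul_zero, zero_mul, Pi.zero_apply]
    · rw [hx, indicator_of_notMem hxZ, zero_mul, zero_mul, Pi.zero_apply]

open scoped Pointwise in
theorem infSup_eq_neg_supInf_neg (ρ : Weight Ω) (k : ℕ) :
    infSup hK ρ k = -supInf hK (-ρ) k := by
  have hneg (F : Submodule ℝ (XK Ω hK)) : rayleighValues (-ρ) F = -rayleighValues ρ F := by
    simp only [rayleighValues, weightForm_neg_weight, ← image_neg_eq_neg, image_image]
  rw [infSup, supInf, Real.sInf_def]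
  congr 2
  ext t
  simp only [mem_neg, mem_ofPred_eq, hneg, Real.sInf_def, neg_neg, neg_eq_iff_eq_neg]

theorem eigenvalue_neg (ρ : Weight Ω) {k : ℤ} (hk : k ≠ 0) :
    eigenvalue hK (-ρ) (-k) = -eigenvalue hK ρ k := by
  rcases hk.lt_or_gt with hk | hk
  · rw [eigenvalue, eigenvalue, if_pos (neg_pos.2 hk), if_neg hk.not_gt, Int.natAbs_neg,
      infSup_eq_neg_supInf_neg, inv_neg, neg_neg]
  · rw [eigenvalue, eigenvalue, if_neg (neg_neg_of_pos hk).not_gt, if_pos hk, Int.natAbs_neg,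
      infSup_eq_neg_supInf_neg, neg_neg, inv_neg]

theorem Admissible.neg {ρ : Weight Ω} {k : ℤ} (h : Admissible ρ k) : Admissible (-ρ) (-k) := by
  rcases h with ⟨hk, hρ⟩ | ⟨hk, hρ⟩
  · exact Or.inr ⟨neg_neg_of_pos hk, by rwa [negPart_neg]⟩
  · exact Or.inl ⟨neg_pos.2 hk, by rwa [posPart_neg]⟩

theorem Admissible.index_ne_zero {ρ : Weight Ω} {k : ℤ} (h : Admissible ρ k) : k ≠ 0 :=
  h.elim (fun h => h.1.ne') (fun h => h.1.ne)

theorem Admissible.weight_ne_zero {ρ : Weight Ω} {k : ℤ} (h : Admissible ρ k) : ρ ≠ 0 := by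
  rintro rfl
  rcases h with ⟨-, h⟩ | ⟨-, h⟩
  · exact h posPart_zero
  · exact h negPart_zero

theorem IsEigenfunction.neg_weight {ρ : Weight Ω} {l : ℝ} {u : XK Ω hK}
    (hu : IsEigenfunction ρ l u) : IsEigenfunction (-ρ) (-l) u :=
  ⟨hu.1, fun v => by rw [weightForm_neg_weight, neg_mul_neg, hu.2 v]⟩

theorem IsEigenfunction.eigenvalue_ne_zero (hΩ : volume Ω ≠ ∞) {ρ : Weight Ω} {l : ℝ}
    {u : XK Ω hK} (hu : IsEigenfunction ρ l u) : l ≠ 0 := by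
  rintro rfl
  exact (energyForm_posDef hΩ u hu.1).ne' ((hu.2 u).trans (zero_mul _))

theorem IsEigenfunction.posPart_ne_zero (hΩ : volume Ω ≠ ∞) {ρ : Weight Ω} {l : ℝ} (hl : 0 < l)
    {u : XK Ω hK} (hu : IsEigenfunction ρ l u) : ρ⁺ ≠ 0 := by
  have hpos : 0 < innerK u u := energyForm_posDef hΩ u hu.1
  rw [hu.2 u] at hpos
  exact posPart_ne_zero_of_weightForm_pos (pos_of_mul_pos_right hpos hl.le)

theorem IsEigenfunction.add_weight {ρ χ : Weight Ω} {l : ℝ} {u : XK Ω hK}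
    (hu : IsEigenfunction ρ l u) (hχ : ∀ v : XK Ω hK, weightForm χ u v = 0) :
    IsEigenfunction (ρ + χ) l u :=
  ⟨hu.1, fun v => by rw [weightForm_add_weight, hχ, add_zero, hu.2 v]⟩

theorem exists_eigenvalue_eq_of_pos (hΩ : volume Ω ≠ ∞) {ρ : Weight Ω} {l : ℝ} (hl : 0 < l)
    {u : XK Ω hK} (hu : IsEigenfunction ρ l u)
    (hzero : volume {x ∈ Ω | u.1 x = 0} ≠ 0) :
    ∃ ρ' : Weight Ω, ρ < ρ' ∧ ∃ k : ℤ, Admissible ρ k ∧ Admissible ρ' k ∧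
      eigenvalue hK ρ k = eigenvalue hK ρ' k := by
  obtain ⟨χ, hχpos, hχ⟩ := exists_weight_supported_on_zeros hΩ hzero
  have heig (v : XK Ω hK) : weightForm ρ u v = l⁻¹ * innerK u v := by
    rw [hu.2 v, inv_mul_cancel_left₀ hl.ne']
  obtain ⟨t, ht, k, hk, hvalue⟩ := exists_maxMin_add_smul_eq (energyForm_posDef hΩ)
    energyForm_isSymm (isFormBounded_weightBilinForm hΩ ρ) (weightBilinForm_isSymm ρ)
    (isFormBounded_weightBilinForm hΩ χ) (weightBilinForm_isPosSemidef hχpos.le)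
    (weightBilinForm_add (hK := hK) ρ χ ▸ isFormCompact_weightBilinForm hΩ (ρ + χ))
    (inv_pos.2 hl) hu.1 heig hχ
  rw [← weightBilinForm_smul, ← weightBilinForm_add, ← supInf_eq_maxMin,
    ← supInf_eq_maxMin] at hvalue
  have hu' : IsEigenfunction (ρ + t • χ) l u :=
    hu.add_weight fun v => by rw [weightForm_smul_weight, hχ, mul_zero]
  have hk' : (0 : ℤ) < k := by exact_mod_cast hk
  refine ⟨ρ + t • χ, lt_add_of_pos_right ρ (lp_smul_pos ht hχpos), k,
    Or.inl ⟨hk', hu.posPart_ne_zero hΩ hl⟩, Or.inl ⟨hk', hu'.posPart_ne_zero hΩ hl⟩, ?_⟩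
  rw [eigenvalue, eigenvalue, if_pos hk', if_pos hk', Int.natAbs_natCast, hvalue]

end Eigenvalues

end NonlocalEig

end

open NonlocalEig in
theorem theorem3p3_general {N : ℕ} (Ω : Set (Space N)) (hΩ : volume Ω ≠ ∞)
    (K : Space N → ℝ) (hK : IsKernel K)
    (ρ : Weight Ω) (hucp : ¬ HasUCP hK ρ) :
    ∃ ρ' : Weight Ω, ρ' ≠ 0 ∧ (ρ ≤ ρ' ∨ ρ' ≤ ρ) ∧ ρ ≠ ρ' ∧
      ∃ k : ℤ, k ≠ 0 ∧ Admissible ρ k ∧ Admissible ρ' k ∧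
        eigenvalue hK ρ k = eigenvalue hK ρ' k := by
  simp only [HasUCP, not_forall] at hucp
  obtain ⟨l, u, hu, hzero⟩ := hucp
  rcases (hu.eigenvalue_ne_zero hΩ).lt_or_gt with hl | hl
  · obtain ⟨σ, hlt, k, hk, hkσ, heq⟩ :=
      exists_eigenvalue_eq_of_pos hΩ (neg_pos.2 hl) hu.neg_weight hzero
    have hρk : Admissible ρ (-k) := by simpa using hk.neg
    refine ⟨-σ, hkσ.neg.weight_ne_zero, Or.inr (neg_le.1 hlt.le), (neg_lt.1 hlt).ne', -k,
      hρk.index_ne_zero, hρk, hkσ.neg, ?_⟩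
    rw [eigenvalue_neg σ hk.index_ne_zero, ← heq,
      ← eigenvalue_neg (-ρ) hk.index_ne_zero, neg_neg]
  · obtain ⟨ρ', hlt, k, hk, hk', heq⟩ := exists_eigenvalue_eq_of_pos hΩ hl hu hzero
    exact ⟨ρ', hk'.weight_ne_zero, Or.inl hlt.le, hlt.ne, k, hk.index_ne_zero, hk, hk', heq⟩

theorem theorem3p3 {N : ℕ} (Ω : Set (NonlocalEig.Space N))
    (hΩ : NonlocalEig.IsLipschitzDomain Ω)
    (K : NonlocalEig.Space N → ℝ) (hK : NonlocalEig.IsKernel K)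
    (ρ : NonlocalEig.Weight Ω) (hρ : ρ ≠ 0) (hucp : ¬ NonlocalEig.HasUCP hK ρ) :
    ∃ ρ' : NonlocalEig.Weight Ω, ρ' ≠ 0 ∧ (ρ ≤ ρ' ∨ ρ' ≤ ρ) ∧ ρ ≠ ρ' ∧
      ∃ k : ℤ, k ≠ 0 ∧ NonlocalEig.Admissible ρ k ∧ NonlocalEig.Admissible ρ' k ∧
        NonlocalEig.eigenvalue hK ρ k = NonlocalEig.eigenvalue hK ρ' k :=
  theorem3p3_general Ω hΩ.isBounded.measure_lt_top.ne K hK ρ hucp
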